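/- **Theorem 7.10.** Let $0<q<1$ be real, let $n,a,b\ge 0$ and $m\ge 1$ be integers, and write $(x;q)_k=\prod_{l=0}^{k-1}(1-xq^l)$. A *reverse plane partition* of square shape $n^n$ is an $n\times n$ array $T=(T_{i,j})_{1\le i,j\le n}$ of non-negative integers that is weakly increasing along rows and along columns; $\mathrm{RPP}(n^n)$ is the set of all of them. For such a $T$ put $|T|=\sum_{i,j}T_{i,j}$, let $(\mu_1,\dots,\mu_n)=(T_{n,n},T_{n-1,n-1},\dots,T_{1,1})$ be its diagonal read from southeast to northwest, let $\mathrm{tr}(T)=\mu_1+\cdots+\mu_n$ and $v_i=\mu_i+n-i$, and define $$ \mathrm{wt}_{a,b,m}(T)=q^{|T|+a\,\mathrm{tr}(T)}\prod_{i=1}^n (q^{v_i+1};q)_b\prod_{1\le i<j\le n}\frac{(q^{v_j})^{2m-1}\,(q^{1-m+v_i-v_j};q)_{2m-1}}{q^{v_j}-q^{v_i}} . $$ The $q$-integral is $\int_c^d f(x)\,d_qx=(1-q)\sum_{l\ge0}\bigl(f(dq^l)\,dq^l-f(cq^l)\,cq^l\bigr)$, and for integers $\alpha,\beta\ge1$ the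 $q$-Selberg integral is $$ S_q(n,\alpha,\beta,m)=\int_{0\le x_1\le\cdots\le x_n\le1}\ \prod_{i=1}^n x_i^{\alpha-1}(qx_i;q)_{\beta-1}\prod_{1\le i<j\le n}x_j^{2m-1}\bigl(q^{1-m}x_i/x_j;q\bigr)_{2m-1}\prod_{1\le i<j\le n}(x_j-x_i)\ d_qx_1\cdots d_qx_n , $$ an iterated $q$-integral in which $x_n$ is the outermost variable and runs from $0$ to $1$, and, for $i<n$, $x_i$ runs from $0$ to $x_{i+1}$ (for $n=0$ it is $1$). Then all series in this iterated $q$-integral converge, the sum of $\mathrm{wt}_{a,b,m}(T)$ over all $T\in\mathrm{RPP}(n^n)$ converges, and $$ \sum_{T\in \mathrm{RPP}(n^n)}\mathrm{wt}_{a,b,m}(T)=\frac{q^{(-1-a)\binom n2-2\binom n3}}{(1-q)^n\prod_{j=1}^{n-1}(q;q)_j^2}\; S_q(n,a+1,b+1,m). $$ -/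

import Mathlib

open scoped BigOperators

noncomputable section

/-- The `q`-shifted factorial `(a;q)_k = (1 - a)(1 - a q) ⋯ (1 - a q^(k-1))`. -/
def qShifted (a q : ℝ) (k : ℕ) : ℝ := ∏ l ∈ Finset.range k, (1 - a * q ^ l)

/-- The `l`-th term of the series (without the factor `1 - q`) that defines the
`q`-integral of `f` from `a` to `b`. -/
def qIntegralTerm (q a b : ℝ) (f : ℝ → ℝ) (l : ℕ) : ℝ :=
  f (b * q ^ l) * (b * q ^ l) - f (a * q ^ l) * (a * q ^ l)

/-- The `q`-integral
`∫_a^b f(x) d_q x = (1 - q) ∑_{l ≥ 0} (f(b q^l) b q^l - f(a q^l) a q^l)`. -/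
def qIntegral (q a b : ℝ) (f : ℝ → ℝ) : ℝ :=
  (1 - q) * ∑' l : ℕ, qIntegralTerm q a b f l

/-- The set of values of the last coordinate on `D ⊆ ℝ^(n+1)`. -/
def lastValues {n : ℕ} (D : Set (Fin (n + 1) → ℝ)) : Set ℝ :=
  (fun x => x (Fin.last n)) '' D

/-- The slice of `D ⊆ ℝ^(n+1)` on which the last coordinate is `t`, as a subset of `ℝ^n`. -/
def lastSlice {n : ℕ} (D : Set (Fin (n + 1) → ℝ)) (t : ℝ) : Set (Fin n → ℝ) :=
  {x | Fin.snoc (α := fun _ => ℝ) x t ∈ D}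

/-- The function of `n` variables obtained from `f` by fixing the last variable to be `t`. -/
def fixLast {n : ℕ} (f : (Fin (n + 1) → ℝ) → ℝ) (t : ℝ) : (Fin n → ℝ) → ℝ :=
  fun x => f (Fin.snoc (α := fun _ => ℝ) x t)

/-- The iterated `q`-integral `∫_D f(x_1, …, x_n) d_q x_1 ⋯ d_q x_n` over a convex polytope
`D ⊆ ℝ^n`. The last variable `x_n` is the outermost one and runs from its minimum to its
maximum on `D`; then `x_{n-1}` runs from its minimum to its maximum on the slice of `D` with
the given value of `x_n`, and so on, and `x_1` is innermost. -/
def qMultiIntegral (q : ℝ) : (n : ℕ) → Set (Fin n → ℝ) → ((Fin n → ℝ) → ℝ) → ℝ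
  | 0, _, f => f Fin.elim0
  | n + 1, D, f =>
      qIntegral q (sInf (lastValues D)) (sSup (lastValues D))
        (fun t => qMultiIntegral q n (lastSlice D t) (fixLast f t))

/-- All the series in the iterated `q`-integral of `f` over `D` converge. -/
def QMultiIntegrable (q : ℝ) : (n : ℕ) → Set (Fin n → ℝ) → ((Fin n → ℝ) → ℝ) → Prop
  | 0, _, _ => True
  | n + 1, D, f =>
      Summable (qIntegralTerm q (sInf (lastValues D)) (sSup (lastValues D))
        (fun t => qMultiIntegral q n (lastSlice D t) (fixLast f t))) ∧
      ∀ l : ℕ, ∀ c ∈ ({sInf (lastValues D), sSup (lastValues D)} : Set ℝ),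
        QMultiIntegrable q n (lastSlice D (c * q ^ l)) (fixLast f (c * q ^ l))

/-- The simplex `0 ≤ x_1 ≤ ⋯ ≤ x_n ≤ 1`. -/
def orderedSimplex (n : ℕ) : Set (Fin n → ℝ) :=
  {x | (∀ i, 0 ≤ x i ∧ x i ≤ 1) ∧ Monotone x}

/-- The integrand
`∏_i x_i^(α-1) (q x_i; q)_(β-1) ∏_{i<j} x_j^(2m-1) (q^(1-m) x_i / x_j; q)_(2m-1) ∏_{i<j} (x_j - x_i)`
of the `q`-Selberg integral, for integers `α, β, m ≥ 1`. -/
def qSelbergIntegrand (q : ℝ) (n α β m : ℕ) (x : Fin n → ℝ) : ℝ :=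
  (∏ i, x i ^ (α - 1) * qShifted (q * x i) q (β - 1)) *
  (∏ i, ∏ j ∈ Finset.Ioi i,
    x j ^ (2 * m - 1) * qShifted (q ^ (1 - (m : ℤ)) * x i / x j) q (2 * m - 1)) *
  ∏ i, ∏ j ∈ Finset.Ioi i, (x j - x i)

/-- The `q`-Selberg integral `S_q(n, α, β, m)`, for integers `α, β, m ≥ 1`. -/
def qSelbergIntegral (q : ℝ) (n α β m : ℕ) : ℝ :=
  qMultiIntegral q n (orderedSimplex n) (qSelbergIntegrand q n α β m)

/-- Reverse plane partitions of the square shape `(n^n)`: fillings of the `n × n` square with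
non-negative integers (`T i j` in row `i` and column `j`) that are weakly increasing along rows
and along columns. -/
def SquareRPP (n : ℕ) : Type :=
  {T : Fin n → Fin n → ℕ // (∀ i, Monotone (T i)) ∧ ∀ j, Monotone fun i => T i j}

namespace SquareRPP

variable {n : ℕ}

/-- `|T|`, the sum of the entries. -/
def size (T : SquareRPP n) : ℕ := ∑ i, ∑ j, T.1 i j

/-- The reverse diagonal `(μ_1, …, μ_n)`: the diagonal entries read from southeast to
northwest. -/
def rdiag (T : SquareRPP n) (i : Fin n) : ℕ := T.1 i.rev i.rev

/-- The trace `μ_1 + ⋯ + μ_n`. -/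
def trace (T : SquareRPP n) : ℕ := ∑ i, T.rdiag i

/-- `v_i = μ_i + n - i` for `i = 1, …, n`; the index `i : Fin n` starts at `0`. -/
def v (T : SquareRPP n) (i : Fin n) : ℕ := T.rdiag i + (n - (i.val + 1))

/-- The weight `wt_{a,b,m}(T)`, for `m ≥ 1`. -/
def wt (q : ℝ) (a b m : ℕ) (T : SquareRPP n) : ℝ :=
  q ^ (T.size + a * T.trace) *
  (∏ i, qShifted (q ^ (T.v i + 1)) q b) *
  ∏ i, ∏ j ∈ Finset.Ioi i,
    (q ^ T.v j) ^ (2 * m - 1) *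
      qShifted (q ^ (1 - (m : ℤ) + (T.v i : ℤ) - (T.v j : ℤ))) q (2 * m - 1) /
      (q ^ T.v j - q ^ T.v i)

end SquareRPP

end

/-!
# Reverse plane partitions of square shape and the `q`-Selberg integral

Both sides are sums over the possible diagonals. The diagonal of a reverse plane partition `T` of
square shape cuts `T` into two triangular fillings with that diagonal, and apart from the factor
`q ^ |T|` the weight depends on the diagonal alone. Removing the diagonal of a triangular filling
leaves a smaller one whose diagonal interlaces with the old one, so the generating function of
triangular fillings obeys the branching rule of Schur polynomials at `1, q, …, q ^ (n - 1)`. That rule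
is also satisfied by a quotient of Vandermonde determinants (`sum_interlacing_vandermonde_div`), by
multilinearity of the determinant and geometric summation; this gives
`TriFilling.hasSum_pow_offDiag`. The reverse plane partitions with diagonal `d` thus contribute the
square of that quotient.

On the other side, the iterated `q`-integral of a bounded function over `0 ≤ x_1 ≤ ⋯ ≤ x_n ≤ 1` is an
absolutely convergent series over the points `q ^ w` with `w` antitone
(`qMultiIntegral_scaledSimplex`). The Vandermonde factor of the `q`-Selberg integrand kills all `w`
that are not strictly decreasing, and strictly decreasing `w` are exactly the sequences
`v_i = μ_i + n - i`. The two series over diagonals then agree term by term (`weight_eq`), where the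
constant comes from the value of the Vandermonde determinant at `1, q, …, q ^ (n - 1)`
(`vandermonde_pow_sq`).
-/

noncomputable section

/-! ### Vandermonde determinants and interlacing sequences -/

open Matrix in
/-- Subtracting from each row of the Vandermonde matrix the preceding one and expanding along the
first column. -/
theorem det_vandermonde_eq_det_sub {n : ℕ} (y : Fin (n + 1) → ℝ) :
    (vandermonde y).det =
      (Matrix.of fun i j : Fin n =>
        y i.succ ^ (j.val + 1) - y i.castSucc ^ (j.val + 1)).det := by
  let B : Matrix (Fin (n + 1)) (Fin (n + 1)) ℝ := Matrix.of fun i j =>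
    Fin.cases (y 0 ^ (j : ℕ)) (fun k => y k.succ ^ (j : ℕ) - y k.castSucc ^ (j : ℕ)) i
  have h1 : (vandermonde y).det = B.det := by
    refine Matrix.det_eq_of_forall_row_eq_smul_add_pred (fun _ => 1) (fun j => ?_)
      (fun i j => ?_)
    · simp [B, vandermonde]
    · simp [B, vandermonde]
  rw [h1, Matrix.det_succ_column_zero, Fin.sum_univ_succ, Finset.sum_eq_zero]
  · simp only [B, Matrix.of_apply, Fin.cases_zero, add_zero, Fin.val_zero, pow_zero, one_mul]
    congr 1
  · intro i _
    simp [B]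

theorem sum_Icc_pow_add {x : ℝ} (hx : x ≠ 1) {a b : ℕ} (hab : a ≤ b) (i : ℕ) :
    ∑ l ∈ Finset.Icc a b, x ^ (l + i) = (x - 1)⁻¹ * (x ^ (b + (i + 1)) - x ^ (a + i)) := by
  have h : Finset.Icc a b = Finset.Ico a (b + 1) := by ext; simp
  simp_rw [pow_add x _ i]
  rw [← Finset.sum_mul, h, geom_sum_Ico hx (by omega)]
  field_simp
  ring

open Matrix in
/-- A sum over all sequences interlacing with `d` is a sum over a box, so multilinearity of the
determinant in its rows turns a sum of Vandermonde determinants into one determinant of geometric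
sums, which is again a Vandermonde determinant with one more node. -/
theorem sum_interlacing_vandermonde {q : ℝ} (hq0 : 0 < q) (hq1 : q < 1) {n : ℕ}
    {d : Fin (n + 1) → ℕ} (hd : Monotone d) :
    ∑ k ∈ Fintype.piFinset fun i : Fin n => Finset.Icc (d i.castSucc) (d i.succ),
        (∏ i, q ^ (k i + i.val)) * (vandermonde fun i => q ^ (k i + i.val)).det =
      (∏ j : Fin n, (q ^ (j.val + 1) - 1)⁻¹) *
        (vandermonde fun i => q ^ (d i + i.val)).det := by
  have h1 : ∀ k : Fin n → ℕ,
      (∏ i, q ^ (k i + i.val)) * (vandermonde fun i => q ^ (k i + i.val)).det =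
        (Matrix.detRowAlternating (R := ℝ)).toMultilinearMap
          (fun i (j : Fin n) => (q ^ (j.val + 1)) ^ (k i + i.val)) := by
    intro k
    rw [← Matrix.det_mul_column]
    change _ = Matrix.det _
    congr 1
    ext i j
    simp only [Matrix.of_apply, vandermonde_apply]
    rw [← pow_succ', ← pow_mul, ← pow_mul, mul_comm]
  simp_rw [h1]
  refine (MultilinearMap.map_sum_finset
    (Matrix.detRowAlternating (R := ℝ) (n := Fin n)).toMultilinearMap
    (fun i (l : ℕ) (j : Fin n) => (q ^ (j.val + 1)) ^ (l + i.val)) _).symm.trans ?_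
  rw [det_vandermonde_eq_det_sub, ← Matrix.det_mul_row]
  change Matrix.det _ = _
  congr 1
  ext i j
  have hx : q ^ (j.val + 1) ≠ 1 := (pow_lt_one₀ hq0.le hq1 (by omega)).ne
  rw [Finset.sum_apply, sum_Icc_pow_add hx (hd i.castSucc_lt_succ.le)]
  simp only [Matrix.of_apply, Fin.val_succ, Fin.val_castSucc]
  rw [← pow_mul, ← pow_mul, ← pow_mul, ← pow_mul, mul_comm (j.val + 1), mul_comm (j.val + 1)]

open Matrix in
/-- The case `d = 0` of `sum_interlacing_vandermonde`, where the box is a single point; it makes the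
normalizing constants cancel in `sum_interlacing_vandermonde_div`. -/
theorem vandermonde_pow_succ {q : ℝ} (hq0 : 0 < q) (hq1 : q < 1) (n : ℕ) :
    (∏ i : Fin n, q ^ i.val) * (vandermonde fun i : Fin n => q ^ i.val).det =
      (∏ j : Fin n, (q ^ (j.val + 1) - 1)⁻¹) *
        (vandermonde fun i : Fin (n + 1) => q ^ i.val).det := by
  have h := sum_interlacing_vandermonde hq0 hq1 (n := n) (d := fun _ => 0) monotone_const
  simpa using h

open Matrix in
theorem vandermonde_pow_ne_zero {q : ℝ} (hq0 : 0 < q) (hq1 : q < 1) (n : ℕ) :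
    (vandermonde fun i : Fin n => q ^ i.val).det ≠ 0 := by
  rw [det_vandermonde_ne_zero_iff]
  intro i j h
  exact Fin.ext ((pow_right_strictAnti₀ hq0 hq1).injective h)

open Matrix in
/-- The quotient of Vandermonde determinants satisfies the branching rule of the Schur polynomial
at `1, q, …, q ^ (n - 1)`. -/
theorem sum_interlacing_vandermonde_div {q : ℝ} (hq0 : 0 < q) (hq1 : q < 1) {n : ℕ}
    {d : Fin (n + 1) → ℕ} (hd : Monotone d) :
    ∑ k ∈ Fintype.piFinset fun i : Fin n => Finset.Icc (d i.castSucc) (d i.succ),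
        q ^ (∑ i, k i) * ((vandermonde fun i => q ^ (k i + i.val)).det /
          (vandermonde fun i : Fin n => q ^ i.val).det) =
      (vandermonde fun i => q ^ (d i + i.val)).det /
        (vandermonde fun i : Fin (n + 1) => q ^ i.val).det := by
  have h0 := vandermonde_pow_ne_zero hq0 hq1 n
  have h1 := vandermonde_pow_ne_zero hq0 hq1 (n + 1)
  have hP : (∏ i : Fin n, q ^ i.val) ≠ 0 := Finset.prod_ne_zero_iff.2 fun i _ => by positivity
  have hs := sum_interlacing_vandermonde hq0 hq1 hd
  have hr := vandermonde_pow_succ hq0 hq1 n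
  rw [eq_div_iff h1, ← mul_right_inj' (mul_ne_zero hP h0)]
  have : ∀ S A B P V W : ℝ, V ≠ 0 → P * V = A * W → P * S = A * B →
      P * V * (S / V * W) = P * V * B := by
    intro S A B P V W hV h2 h3
    field_simp
    rw [h3, h2]
    ring
  refine Eq.trans ?_ (this (∑ k ∈ Fintype.piFinset fun i : Fin n =>
    Finset.Icc (d i.castSucc) (d i.succ), q ^ (∑ i, k i) *
      (vandermonde fun i => q ^ (k i + i.val)).det) _ _ _ _ _ h0 hr ?_)
  · rw [Finset.sum_div]
    simp_rw [mul_div_assoc]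
  · rw [← hs, Finset.mul_sum]
    refine Finset.sum_congr rfl fun k _ => ?_
    simp_rw [pow_add q (k _), Finset.prod_mul_distrib, Finset.prod_pow_eq_pow_sum]
    ring

/-! ### Triangular fillings -/

/-- Fillings of the upper triangle `i ≤ j` of an `n × n` square by natural numbers, weakly
increasing along rows and columns, with prescribed diagonal `d`. The entries below the diagonal are
set to `0`, so that a filling is determined by its values on the triangle. These are the
Gelfand-Tsetlin patterns whose longest row is `d`. -/
def TriFilling (n : ℕ) (d : Fin n → ℕ) : Type :=
  {u : Fin n → Fin n → ℕ // (∀ i, u i i = d i) ∧ (∀ i j, j < i → u i j = 0) ∧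
    (∀ i j k, i ≤ j → j ≤ k → u i j ≤ u i k) ∧ ∀ i j k, i ≤ j → j ≤ k → u i k ≤ u j k}

namespace TriFilling

/-- The sum of the entries strictly above the diagonal. -/
def offDiag {n : ℕ} {d : Fin n → ℕ} (u : TriFilling n d) : ℕ :=
  ∑ i, ∑ j ∈ Finset.Ioi i, u.1 i j

/-- Remove the diagonal: what remains is a triangular filling of size `n`, whose diagonal
interlaces with `d`. -/
def peel {n : ℕ} {d : Fin (n + 1) → ℕ} (u : TriFilling (n + 1) d) :
    Σ k : Fintype.piFinset fun i : Fin n => Finset.Icc (d i.castSucc) (d i.succ),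
      TriFilling n k.1 :=
  ⟨⟨fun i => u.1 i.castSucc i.succ, by
    obtain ⟨u, h1, h2, h3, h4⟩ := u
    rw [Fintype.mem_piFinset]
    intro i
    rw [Finset.mem_Icc, ← h1, ← h1]
    exact ⟨h3 _ _ _ le_rfl i.castSucc_lt_succ.le, h4 _ _ _ i.castSucc_lt_succ.le le_rfl⟩⟩,
   ⟨fun i j => if i ≤ j then u.1 i.castSucc j.succ else 0, by
    obtain ⟨u, h1, h2, h3, h4⟩ := u
    refine ⟨fun i => by simp, fun i j h => by simp [h], fun i j k hij hjk => ?_,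
      fun i j k hij hjk => ?_⟩
    · simp only [hij, hij.trans hjk, if_true]
      exact h3 _ _ _ ((Fin.castSucc_le_castSucc_iff.2 hij).trans j.castSucc_lt_succ.le)
        (Fin.succ_le_succ_iff.2 hjk)
    · simp only [hjk, hij.trans hjk, if_true]
      exact h4 _ _ _ (Fin.castSucc_le_castSucc_iff.2 hij)
        ((Fin.castSucc_le_castSucc_iff.2 hjk).trans k.castSucc_lt_succ.le)⟩⟩

theorem ext {n : ℕ} {d : Fin n → ℕ} {u w : TriFilling n d}
    (h : ∀ i j, i < j → u.1 i j = w.1 i j) : u = w := by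
  refine Subtype.ext (funext fun i => funext fun j => ?_)
  rcases lt_trichotomy i j with hij | rfl | hij
  · exact h i j hij
  · rw [u.2.1, w.2.1]
  · rw [u.2.2.1 i j hij, w.2.2.1 i j hij]

theorem peel_bijective {n : ℕ} (d : Fin (n + 1) → ℕ) :
    Function.Bijective (peel (d := d)) := by
  constructor
  · intro u w h
    refine ext fun i j hij => ?_
    obtain ⟨i, rfl⟩ := Fin.exists_castSucc_eq.2 (ne_of_lt (hij.trans_le (Fin.le_last j)))
    obtain ⟨j, rfl⟩ := Fin.exists_succ_eq.2 (ne_of_gt ((Fin.zero_le _).trans_lt hij))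
    have hle : i ≤ j := by
      rw [Fin.castSucc_lt_succ_iff] at hij; exact hij
    have := congrArg (fun p : (Σ k : Fintype.piFinset fun i : Fin n =>
      Finset.Icc (d i.castSucc) (d i.succ), TriFilling n k.1) => p.2.1 i j) h
    simpa [peel, hle] using this
  · rintro ⟨⟨k, hk⟩, u, h1, h2, h3, h4⟩
    have hk' : ∀ i, d i.castSucc ≤ k i ∧ k i ≤ d i.succ := by
      simpa [Fintype.mem_piFinset] using hk
    dsimp only at h1
    -- The filling with diagonal `d` placed in front of the smaller filling `u`.
    let w : Fin (n + 1) → Fin (n + 1) → ℕ := fun i j =>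
      if h : i < j then u ⟨i, by omega⟩ ⟨j - 1, by omega⟩ else if i = j then d i else 0
    have wlt : ∀ i j : Fin n, i ≤ j → w i.castSucc j.succ = u i j := by
      intro i j hij
      have : i.castSucc < j.succ := Fin.castSucc_lt_succ_iff.2 hij
      simp [w, this]
    have weq : ∀ i, w i i = d i := by intro i; simp [w]
    have wgt : ∀ i j, j < i → w i j = 0 := by
      intro i j h; simp [w, h.not_gt, h.ne']
    have eq_or_succ : ∀ i j : Fin (n + 1), i ≤ j → i = j ∨
        ∃ i' j' : Fin n, i' ≤ j' ∧ i = i'.castSucc ∧ j = j'.succ := by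
      intro i j hij
      rcases hij.eq_or_lt with h | h
      · exact .inl h
      · obtain ⟨i, rfl⟩ := Fin.exists_castSucc_eq.2 (ne_of_lt (h.trans_le (Fin.le_last j)))
        obtain ⟨j, rfl⟩ := Fin.exists_succ_eq.2 (ne_of_gt ((Fin.zero_le _).trans_lt h))
        exact .inr ⟨i, j, by rwa [Fin.castSucc_lt_succ_iff] at h, rfl, rfl⟩
    refine ⟨⟨w, weq, wgt, fun i j l hij hjl => ?_, fun i j l hij hjl => ?_⟩, ?_⟩
    · rcases eq_or_succ i l (hij.trans hjl) with rfl | ⟨i', l', hil, rfl, rfl⟩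
      · rw [le_antisymm hjl hij]
      · rw [wlt _ _ hil]
        rcases eq_or_succ _ _ hij with rfl | ⟨a, j', hij', ha, rfl⟩
        · rw [weq]
          exact (hk' i').1.trans ((h1 i').symm.le.trans (h3 _ _ _ le_rfl hil))
        · obtain rfl := Fin.castSucc_injective _ ha
          rw [wlt _ _ hij']
          exact h3 _ _ _ hij' (Fin.succ_le_succ_iff.1 hjl)
    · rcases eq_or_succ i l (hij.trans hjl) with rfl | ⟨i', l', hil, rfl, rfl⟩
      · rw [le_antisymm hjl hij]
      · rw [wlt _ _ hil]
        rcases eq_or_succ _ _ hjl with rfl | ⟨j', a, hij', rfl, ha⟩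
        · rw [weq]
          exact (h4 _ _ _ hil le_rfl).trans ((h1 l').le.trans (hk' l').2)
        · obtain rfl := Fin.succ_injective _ ha
          rw [wlt _ _ hij']
          exact h4 _ _ _ (Fin.castSucc_le_castSucc_iff.1 hij) hij'
    · have hw : (fun i : Fin n => w i.castSucc i.succ) = k := by
        funext i; rw [wlt i i le_rfl, h1]
      subst hw
      refine Sigma.ext rfl (heq_of_eq (ext fun i j hij => ?_))
      simp [peel, hij.le, wlt]

theorem sum_Ioi_eq {n : ℕ} (f : Fin n → Fin n → ℕ) :
    ∑ i, ∑ j ∈ Finset.Ioi i, f i j = ∑ i, ∑ j, if i < j then f i j else 0 := by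
  refine Finset.sum_congr rfl fun i _ => ?_
  rw [← Finset.sum_filter]
  congr 1
  ext; simp

theorem offDiag_peel {n : ℕ} {d : Fin (n + 1) → ℕ} (u : TriFilling (n + 1) d) :
    u.offDiag = ∑ i, u.peel.1.1 i + u.peel.2.offDiag := by
  unfold offDiag
  rw [sum_Ioi_eq, sum_Ioi_eq, Fin.sum_univ_castSucc]
  simp_rw [Fin.sum_univ_succ (fun j => if _ < j then _ else 0)]
  have h0 : ∀ x : Fin n, ¬ Fin.last n < x.succ := fun x => (Fin.le_last _).not_gt
  simp only [peel, Fin.not_lt_zero, if_false, zero_add, h0, Finset.sum_const_zero, add_zero,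
    Fin.castSucc_lt_succ_iff]
  rw [← Finset.sum_add_distrib]
  refine Finset.sum_congr rfl fun i _ => ?_
  rw [← Finset.sum_ite_eq (Finset.univ) i (fun j => u.1 i.castSucc j.succ) |>.trans
    (if_pos (Finset.mem_univ i)), ← Finset.sum_add_distrib]
  refine Finset.sum_congr rfl fun j _ => ?_
  rcases lt_trichotomy i j with h | h | h
  · simp [h, h.le, h.ne]
  · simp [h]
  · simp [h.not_ge, h.not_gt, h.ne']

end TriFilling

/-- A double series whose inner sums and absolute inner sums are known, the latter summable.
No sign assumption on the terms is needed. -/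
theorem hasSum_sigma_of_abs {α : Type*} {β : α → Type*} {f : (Σ a, β a) → ℝ} {g g' : α → ℝ}
    {s : ℝ} (hg : HasSum g s) (hg' : Summable g') (hf : ∀ a, HasSum (fun b => f ⟨a, b⟩) (g a))
    (hf' : ∀ a, HasSum (fun b => |f ⟨a, b⟩|) (g' a)) : HasSum f s := by
  refine HasSum.sigma_of_hasSum hg hf (Summable.of_abs ?_)
  refine (summable_sigma_of_nonneg fun _ => abs_nonneg _).2 ⟨fun a => (hf' a).summable, ?_⟩
  simpa only [fun a => (hf' a).tsum_eq] using hg'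

open Matrix in
/-- The generating function of the triangular fillings with diagonal `d` is the Schur polynomial
of the partition with parts `d i`, at `1, q, …, q ^ (n - 1)`, in Weyl's form. -/
theorem TriFilling.hasSum_pow_offDiag {q : ℝ} (hq0 : 0 < q) (hq1 : q < 1) :
    ∀ {n : ℕ} {d : Fin n → ℕ}, Monotone d →
      HasSum (fun u : TriFilling n d => q ^ u.offDiag)
        ((vandermonde fun i => q ^ (d i + i.val)).det /
          (vandermonde fun i : Fin n => q ^ i.val).det)
  | 0, d, _ => by
    let u : TriFilling 0 d := ⟨fun i => i.elim0, fun i => i.elim0, fun i => i.elim0,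
      fun i => i.elim0, fun i => i.elim0⟩
    have hu : ∀ w : TriFilling 0 d, w = u := fun w => ext fun i => i.elim0
    convert hasSum_single u fun w hw => (hw (hu w)).elim using 1
    simp [offDiag]
  | n + 1, d, hd => by
    rw [← sum_interlacing_vandermonde_div hq0 hq1 hd]
    have hs := Finset.hasSum (Fintype.piFinset fun i : Fin n =>
      Finset.Icc (d i.castSucc) (d i.succ)) (fun k => q ^ (∑ i, k i) *
        ((vandermonde fun i => q ^ (k i + i.val)).det /
          (vandermonde fun i : Fin n => q ^ i.val).det))
    have hfib : ∀ k : Fintype.piFinset fun i : Fin n => Finset.Icc (d i.castSucc) (d i.succ),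
        HasSum (fun u : TriFilling n k.1 => q ^ (∑ i, k.1 i + u.offDiag))
          (q ^ (∑ i, k.1 i) * ((vandermonde fun i => q ^ (k.1 i + i.val)).det /
          (vandermonde fun i : Fin n => q ^ i.val).det)) := by
      rintro ⟨k, hk⟩
      have hk' : ∀ i, d i.castSucc ≤ k i ∧ k i ≤ d i.succ := by
        simpa [Fintype.mem_piFinset] using hk
      have hmono : Monotone k := by
        intro i j hij
        rcases hij.eq_or_lt with rfl | h
        · exact le_rfl
        · exact (hk' i).2.trans ((hd (Fin.succ_le_castSucc_iff.2 h)).trans (hk' j).1)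
      simp_rw [pow_add q (∑ i, k i)]
      exact (hasSum_pow_offDiag hq0 hq1 hmono).mul_left _
    have := hasSum_sigma_of_abs (f := fun p : (Σ k : Fintype.piFinset fun i : Fin n =>
      Finset.Icc (d i.castSucc) (d i.succ), TriFilling n k.1) =>
        q ^ (∑ i, p.1.1 i + p.2.offDiag)) hs hs.summable hfib
        (by simp_rw [abs_of_pos (pow_pos hq0 _)]; exact hfib)
    rw [← (Equiv.ofBijective _ (peel_bijective d)).hasSum_iff] at this
    convert this using 1
    funext u
    rw [offDiag_peel]
    rfl

/-! ### Iterated integrals over a simplex as multiple series -/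

theorem summable_pi_geometric {q : ℝ} (hq0 : 0 < q) (hq1 : q < 1) :
    ∀ n : ℕ, Summable fun w : Fin n → ℕ => ∏ i, q ^ w i
  | 0 => (hasSum_fintype _).summable
  | n + 1 => by
    have h := (summable_geometric_of_lt_one hq0.le hq1).mul_of_nonneg
      (summable_pi_geometric hq0 hq1 n) (fun _ => by positivity) (fun _ => by positivity)
    rw [← (Fin.consEquiv fun _ : Fin (n + 1) => ℕ).summable_iff]
    refine h.congr fun p => ?_
    simp [Fin.prod_univ_succ, Fin.consEquiv]

/-- The simplex `0 ≤ x_1 ≤ ⋯ ≤ x_n ≤ t`. Its slice at last coordinate `s` is the simplex of one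
dimension less scaled to `s`, so the family is closed under the recursion of the iterated
integral. -/
def scaledSimplex (n : ℕ) (t : ℝ) : Set (Fin n → ℝ) :=
  {x | (∀ i, 0 ≤ x i ∧ x i ≤ t) ∧ Monotone x}

theorem snoc_mem_scaledSimplex {n : ℕ} {t s : ℝ} (hs : 0 ≤ s) (hst : s ≤ t) (x : Fin n → ℝ) :
    Fin.snoc (α := fun _ => ℝ) x s ∈ scaledSimplex (n + 1) t ↔ x ∈ scaledSimplex n s := by
  constructor
  · rintro ⟨h1, h2⟩
    refine ⟨fun i => ⟨?_, ?_⟩, fun i j hij => ?_⟩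
    · simpa using (h1 i.castSucc).1
    · simpa using h2 (Fin.le_last i.castSucc)
    · simpa using h2 (Fin.castSucc_le_castSucc_iff.2 hij)
  · rintro ⟨h1, h2⟩
    refine ⟨fun i => ?_, fun i j hij => ?_⟩
    · refine Fin.lastCases ?_ (fun i => ?_) i
      · simpa using ⟨hs, hst⟩
      · simpa using ⟨(h1 i).1, (h1 i).2.trans hst⟩
    · induction j using Fin.lastCases with
      | last =>
        induction i using Fin.lastCases with
        | last => exact le_rfl
        | cast i => simpa using (h1 i).2
      | cast j =>
        induction i using Fin.lastCases with
        | last => exact absurd hij (Fin.castSucc_lt_last j).not_ge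
        | cast i => simpa using h2 (Fin.castSucc_le_castSucc_iff.1 hij)

theorem lastSlice_scaledSimplex {n : ℕ} {t s : ℝ} (hs : 0 ≤ s) (hst : s ≤ t) :
    lastSlice (scaledSimplex (n + 1) t) s = scaledSimplex n s :=
  Set.ext fun x => snoc_mem_scaledSimplex hs hst x

theorem lastValues_scaledSimplex {n : ℕ} {t : ℝ} :
    lastValues (scaledSimplex (n + 1) t) = Set.Icc 0 t := by
  ext s
  constructor
  · rintro ⟨x, hx, rfl⟩
    exact hx.1 _
  · intro hs
    exact ⟨fun _ => s, ⟨fun _ => hs, monotone_const⟩, rfl⟩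

/-- An antitone sequence of length `n + 1` as its last value `l` together with the antitone
sequence of the first `n` values, diminished by `l`. -/
def antitoneSnocEquiv (n : ℕ) :
    ℕ × {w : Fin n → ℕ // Antitone w} ≃ {w : Fin (n + 1) → ℕ // Antitone w} where
  toFun p := ⟨Fin.snoc (α := fun _ => ℕ) (fun i => p.1 + p.2.1 i) p.1, by
    intro i j hij
    induction j using Fin.lastCases with
    | last =>
      induction i using Fin.lastCases with
      | last => exact le_rfl
      | cast i => simp
    | cast j =>
      induction i using Fin.lastCases with
      | last => exact absurd hij (Fin.castSucc_lt_last j).not_ge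
      | cast i => simpa using p.2.2 (Fin.castSucc_le_castSucc_iff.1 hij)⟩
  invFun w := ⟨w.1 (Fin.last n), fun i => w.1 i.castSucc - w.1 (Fin.last n), fun i j hij =>
    Nat.sub_le_sub_right (w.2 (Fin.castSucc_le_castSucc_iff.2 hij)) _⟩
  left_inv p := by simp
  right_inv w := by
    refine Subtype.ext (funext fun i => ?_)
    induction i using Fin.lastCases with
    | last => simp
    | cast i => simpa using Nat.add_sub_cancel' (w.2 (Fin.le_last i.castSucc))

/-- The iterated `q`-integral of a bounded function over the simplex converges, and it equals an
absolutely convergent multiple series over the points `t * q ^ w`, with `w` antitone. Boundedness is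
only needed on the simplex. -/
theorem qMultiIntegral_scaledSimplex {q : ℝ} (hq0 : 0 < q) (hq1 : q < 1) :
    ∀ {n : ℕ} {t : ℝ}, 0 ≤ t → ∀ {f : (Fin n → ℝ) → ℝ} {C : ℝ},
      (∀ x ∈ scaledSimplex n t, |f x| ≤ C) →
      QMultiIntegrable q n (scaledSimplex n t) f ∧
      HasSum (fun w : {w : Fin n → ℕ // Antitone w} =>
        (1 - q) ^ n * (f (fun i => t * q ^ w.1 i) * ∏ i, (t * q ^ w.1 i)))
        (qMultiIntegral q n (scaledSimplex n t) f)
  | 0, t, _, f, _, _ => by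
    refine ⟨trivial, ?_⟩
    let w₀ : {w : Fin 0 → ℕ // Antitone w} := ⟨Fin.elim0, fun i => i.elim0⟩
    convert hasSum_single w₀ fun w hw =>
      (hw (Subtype.ext (funext fun i => i.elim0))).elim using 1
    simp only [qMultiIntegral, pow_zero, Finset.univ_eq_empty, Finset.prod_empty, mul_one,
      one_mul]
    congr 1
    exact funext fun i => i.elim0
  | n + 1, t, ht, f, C, hf => by
    have hqn : ∀ l : ℕ, 0 ≤ q ^ l ∧ q ^ l ≤ 1 := fun l =>
      ⟨by positivity, pow_le_one₀ hq0.le hq1.le⟩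
    have ih : ∀ s, 0 ≤ s → s ≤ t → _ := fun s hs hst =>
      qMultiIntegral_scaledSimplex hq0 hq1 (n := n) hs (f := fixLast f s) (C := C)
        (fun x hx => hf _ ((snoc_mem_scaledSimplex hs hst x).2 hx))
    have hsl : ∀ l : ℕ, 0 ≤ t * q ^ l ∧ t * q ^ l ≤ t := fun l =>
      ⟨mul_nonneg ht (hqn l).1, mul_le_of_le_one_right ht (hqn l).2⟩
    have hmem : ∀ w : Fin (n + 1) → ℕ, Antitone w →
        (fun i => t * q ^ w i) ∈ scaledSimplex (n + 1) t := fun w hw =>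
      ⟨fun i => hsl _, fun i j hij => mul_le_mul_of_nonneg_left
        (pow_le_pow_of_le_one hq0.le hq1.le (hw hij)) ht⟩
    have hsum : Summable (fun w : {w : Fin (n + 1) → ℕ // Antitone w} =>
        (1 - q) ^ (n + 1) * (f (fun i => t * q ^ w.1 i) * ∏ i, (t * q ^ w.1 i))) := by
      refine Summable.mul_left _ (Summable.of_norm_bounded
        (((summable_pi_geometric hq0 hq1 (n + 1)).mul_left (C * t ^ (n + 1))).subtype _)
        fun w => ?_)
      rw [Function.comp_apply, Real.norm_eq_abs, abs_mul, Finset.prod_mul_distrib]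
      simp only [Finset.prod_const, Finset.card_univ, Fintype.card_fin]
      rw [abs_of_nonneg (a := t ^ (n + 1) * _) (by positivity), mul_assoc]
      exact mul_le_mul_of_nonneg_right (hf _ (hmem _ w.2)) (by positivity)
    rw [← (antitoneSnocEquiv n).summable_iff] at hsum
    have hI : sInf (lastValues (scaledSimplex (n + 1) t)) = 0 := by
      rw [lastValues_scaledSimplex, csInf_Icc ht]
    have hS : sSup (lastValues (scaledSimplex (n + 1) t)) = t := by
      rw [lastValues_scaledSimplex, csSup_Icc ht]
    have hterm : ∀ l : ℕ, qIntegralTerm q 0 t (fun s => qMultiIntegral q n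
        (lastSlice (scaledSimplex (n + 1) t) s) (fixLast f s)) l =
        qMultiIntegral q n (scaledSimplex n (t * q ^ l)) (fixLast f (t * q ^ l)) *
          (t * q ^ l) := by
      intro l
      simp only [qIntegralTerm, zero_mul, mul_zero, sub_zero]
      rw [lastSlice_scaledSimplex (hsl l).1 (hsl l).2]
    have hfib := hsum.hasSum.prod_fiberwise
      (g := fun l => (1 - q) * qIntegralTerm q 0 t (fun s => qMultiIntegral q n
        (lastSlice (scaledSimplex (n + 1) t) s) (fixLast f s)) l) fun l => by
      rw [hterm]
      have := ((ih _ (hsl l).1 (hsl l).2).2.mul_right (t * q ^ l)).mul_left (1 - q)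
      refine Eq.mp (congrArg (fun g => HasSum g _) (funext fun w => Eq.symm ?_)) this
      have harg : (fun i => t * q ^ (antitoneSnocEquiv n (l, w)).1 i) =
          Fin.snoc (α := fun _ => ℝ) (fun i => t * q ^ l * q ^ w.1 i) (t * q ^ l) := by
        funext i
        induction i using Fin.lastCases with
        | last => simp [antitoneSnocEquiv]
        | cast i => simp [antitoneSnocEquiv, pow_add, mul_assoc]
      simp only [Function.comp_apply]
      rw [Fin.prod_univ_castSucc]
      have hlast : (antitoneSnocEquiv n (l, w)).1 (Fin.last n) = l := by
        simp [antitoneSnocEquiv]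
      have hcast : ∀ i : Fin n, (antitoneSnocEquiv n (l, w)).1 i.castSucc = l + w.1 i := fun i => by
        simp [antitoneSnocEquiv]
      rw [harg, hlast]
      simp only [hcast, fixLast, pow_add, mul_assoc]
      ring
    have hq : (1 - q) ≠ 0 := by linarith
    have hst : Summable (qIntegralTerm q 0 t (fun s => qMultiIntegral q n
        (lastSlice (scaledSimplex (n + 1) t) s) (fixLast f s))) :=
      (summable_mul_left_iff hq).1 hfib.summable
    rw [QMultiIntegrable, qMultiIntegral, hI, hS, qIntegral]
    refine ⟨⟨hst, ?_⟩, ?_⟩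
    -- The endpoint `c = 0` is covered too: the slice there is the simplex scaled by `0`.
    · intro l c hc
      have : 0 ≤ c * q ^ l ∧ c * q ^ l ≤ t := by
        rcases hc with rfl | rfl
        · simpa using ht
        · exact hsl l
      rw [lastSlice_scaledSimplex this.1 this.2]
      exact (ih _ this.1 this.2).1
    · rw [← tsum_mul_left, hfib.tsum_eq, ← (antitoneSnocEquiv n).hasSum_iff]
      exact hsum.hasSum

/-! ### Boundedness of the `q`-Selberg integrand -/

theorem abs_qShifted_le_prod {q : ℝ} (hq0 : 0 < q) {x c : ℝ} (hx : |x| ≤ c) (k : ℕ) :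
    |qShifted x q k| ≤ ∏ l ∈ Finset.range k, (1 + c * q ^ l) := by
  rw [qShifted, Finset.abs_prod]
  refine Finset.prod_le_prod (fun _ _ => abs_nonneg _) fun l _ => ?_
  refine (abs_sub _ _).trans ?_
  rw [abs_one, abs_mul, abs_of_pos (pow_pos hq0 l)]
  gcongr

/-- On the simplex `0 ≤ x i ≤ x j`, hence `x i / x j ∈ [0, 1]`, also with the convention
`x i / 0 = 0`. -/
theorem abs_qSelbergIntegrand_le {q : ℝ} (hq0 : 0 < q) (n α β m : ℕ) :
    ∃ C, ∀ x ∈ orderedSimplex n, |qSelbergIntegrand q n α β m x| ≤ C := by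
  let c := q ^ (1 - (m : ℤ))
  refine ⟨(∏ _i : Fin n, ∏ l ∈ Finset.range (β - 1), (1 + q * q ^ l)) *
    (∏ i : Fin n, ∏ _j ∈ Finset.Ioi i, ∏ l ∈ Finset.range (2 * m - 1), (1 + c * q ^ l)) *
    ∏ i : Fin n, ∏ _j ∈ Finset.Ioi i, 1, ?_⟩
  rintro x ⟨hx, hmono⟩
  have hc : 0 < c := by positivity
  have hpow : ∀ i k, |x i ^ k| ≤ 1 := fun i k => by
    rw [abs_of_nonneg (pow_nonneg (hx i).1 _)]
    exact pow_le_one₀ (hx i).1 (hx i).2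
  have h1 : ∀ i, |x i ^ (α - 1) * qShifted (q * x i) q (β - 1)| ≤
      ∏ l ∈ Finset.range (β - 1), (1 + q * q ^ l) := fun i => by
    rw [abs_mul]
    refine (mul_le_of_le_one_left (abs_nonneg _) (hpow i _)).trans
      (abs_qShifted_le_prod hq0 ?_ _)
    rw [abs_mul, abs_of_pos hq0, abs_of_nonneg (hx i).1]
    exact mul_le_of_le_one_right hq0.le (hx i).2
  have h2 : ∀ i j, i ≤ j → |x j ^ (2 * m - 1) *
      qShifted (q ^ (1 - (m : ℤ)) * x i / x j) q (2 * m - 1)| ≤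
        ∏ l ∈ Finset.range (2 * m - 1), (1 + c * q ^ l) := fun i j hij => by
    rw [abs_mul]
    refine (mul_le_of_le_one_left (abs_nonneg _) (hpow j _)).trans
      (abs_qShifted_le_prod hq0 ?_ _)
    rw [mul_div_assoc, abs_mul, abs_of_pos hc,
      abs_of_nonneg (div_nonneg (hx i).1 (hx j).1)]
    exact mul_le_of_le_one_right hc.le (div_le_one_of_le₀ (hmono hij) (hx j).1)
  have h3 : ∀ i j, |x j - x i| ≤ 1 := fun i j => by
    rw [abs_le]
    constructor <;> linarith [(hx i).1, (hx i).2, (hx j).1, (hx j).2]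
  rw [qSelbergIntegrand, abs_mul, abs_mul]
  simp only [Finset.abs_prod]
  have hn : ∀ i : Fin n, ∀ j ∈ Finset.Ioi i, i ≤ j := fun i j hj => (Finset.mem_Ioi.1 hj).le
  refine mul_le_mul (mul_le_mul ?_ ?_ (by positivity) (by positivity)) ?_ (by positivity)
    (by positivity)
  · exact Finset.prod_le_prod (fun _ _ => abs_nonneg _) fun i _ => h1 i
  · exact Finset.prod_le_prod (fun _ _ => by positivity) fun i _ =>
      Finset.prod_le_prod (fun _ _ => abs_nonneg _) fun j hj => h2 i j (hn i j hj)
  · exact Finset.prod_le_prod (fun _ _ => by positivity) fun i _ =>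
      Finset.prod_le_prod (fun _ _ => abs_nonneg _) fun j _ => h3 i j

/-! ### Cutting a square along its diagonal -/

theorem hasSum_mul_of_nonneg {α : Type*} {f : α → ℝ} {s : ℝ} (h0 : ∀ x, 0 ≤ f x)
    (h : HasSum f s) : HasSum (fun p : α × α => f p.1 * f p.2) (s * s) := by
  have hs : Summable fun p : α × α => f p.1 * f p.2 :=
    Summable.mul_of_nonneg h.summable h.summable h0 h0
  exact h.mul h hs

open Matrix in
/-- A reverse plane partition of square shape is a pair of triangular fillings with a common
diagonal; this is the generating function of such pairs. -/
theorem TriFilling.hasSum_pow_offDiag_add {q : ℝ} (hq0 : 0 < q) (hq1 : q < 1) {n : ℕ}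
    {d : Fin n → ℕ} (hd : Monotone d) :
    HasSum (fun p : TriFilling n d × TriFilling n d => q ^ (p.1.offDiag + p.2.offDiag))
      (((vandermonde fun i => q ^ (d i + i.val)).det /
        (vandermonde fun i : Fin n => q ^ i.val).det) ^ 2) := by
  have h := hasSum_mul_of_nonneg (f := fun u : TriFilling n d => q ^ u.offDiag)
    (fun _ => (pow_pos hq0 _).le) (hasSum_pow_offDiag hq0 hq1 hd)
  simp only [← pow_add] at h
  rw [sq]
  exact h

namespace SquareRPP

/-- The square array with `u` on and above the diagonal and the transpose of `w` below it. -/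
def glueFun {n : ℕ} {d : Fin n → ℕ} (u w : TriFilling n d) (i j : Fin n) : ℕ :=
  if i ≤ j then u.1 i j else w.1 j i

theorem glueFun_swap {n : ℕ} {d : Fin n → ℕ} (u w : TriFilling n d) (i j : Fin n) :
    glueFun u w i j = glueFun w u j i := by
  unfold glueFun
  rcases lt_trichotomy i j with h | rfl | h
  · simp [h.le, h.not_ge]
  · simp [u.2.1, w.2.1]
  · simp [h.le, h.not_ge]

theorem glueFun_self {n : ℕ} {d : Fin n → ℕ} (u w : TriFilling n d) (i : Fin n) :
    glueFun u w i i = d i := by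
  simp [glueFun, u.2.1]

theorem monotone_glueFun {n : ℕ} {d : Fin n → ℕ} (u w : TriFilling n d) (i : Fin n) :
    Monotone (glueFun u w i) := by
  have hle : ∀ j k, i ≤ j → j ≤ k → glueFun u w i j ≤ glueFun u w i k := fun j k hij hjk => by
    simpa only [glueFun, hij, hij.trans hjk, if_true] using u.2.2.2.1 _ _ _ hij hjk
  have hge : ∀ j k, j ≤ k → k ≤ i → glueFun u w i j ≤ glueFun u w i k := fun j k hjk hki => by
    rw [glueFun_swap, glueFun_swap u]
    simpa only [glueFun, hki, hjk.trans hki, if_true] using w.2.2.2.2 _ _ _ hjk hki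
  intro j k hjk
  rcases le_total i j with h | h
  · exact hle j k h hjk
  · rcases le_total i k with h' | h'
    · exact (hge j i h le_rfl).trans (hle i k le_rfl h')
    · exact hge j k hjk h'

/-- The reverse plane partition with diagonal `d` assembled from two triangular fillings. -/
def glue {n : ℕ} (p : Σ d : {d : Fin n → ℕ // Monotone d}, TriFilling n d.1 × TriFilling n d.1) :
    SquareRPP n :=
  ⟨glueFun p.2.1 p.2.2, monotone_glueFun _ _, fun j => by
    simpa only [glueFun_swap p.2.1] using monotone_glueFun p.2.2 p.2.1 j⟩

theorem glue_bijective (n : ℕ) : Function.Bijective (glue (n := n)) := by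
  constructor
  · rintro ⟨⟨d, hd⟩, u, w⟩ ⟨⟨d', hd'⟩, u', w'⟩ h
    have h' : ∀ i j, glueFun u w i j = glueFun u' w' i j := fun i j =>
      congrFun (congrFun (congrArg Subtype.val h) i) j
    obtain rfl : d = d' := funext fun i => by simpa only [glueFun_self] using h' i i
    obtain rfl : u = u' := TriFilling.ext fun i j hij => by
      simpa [glueFun, hij.le] using h' i j
    obtain rfl : w = w' := TriFilling.ext fun i j hij => by
      simpa [glueFun, hij.not_ge] using h' j i
    rfl
  · intro T
    refine ⟨⟨⟨fun i => T.1 i i, fun i j hij => (T.2.1 i hij).trans (T.2.2 j hij)⟩,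
      ⟨fun i j => if i ≤ j then T.1 i j else 0, by simp, fun i j h => by simp [h],
        fun i j k hij hjk => ?_, fun i j k hij hjk => ?_⟩,
      ⟨fun i j => if i ≤ j then T.1 j i else 0, by simp, fun i j h => by simp [h],
        fun i j k hij hjk => ?_, fun i j k hij hjk => ?_⟩⟩, ?_⟩
    · simpa [hij, hij.trans hjk] using T.2.1 i hjk
    · simpa [hjk, hij.trans hjk] using T.2.2 k hij
    · simpa [hij, hij.trans hjk] using T.2.2 i hjk
    · simpa [hjk, hij.trans hjk] using T.2.1 k hij
    · refine Subtype.ext (funext fun i => funext fun j => ?_)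
      by_cases h : i ≤ j
      · simp [glue, glueFun, h]
      · simp [glue, glueFun, h, (lt_of_not_ge h).le]

variable {n : ℕ}
  (p : Σ d : {d : Fin n → ℕ // Monotone d}, TriFilling n d.1 × TriFilling n d.1)

theorem rdiag_glue (i : Fin n) : (glue p).rdiag i = p.1.1 i.rev := glueFun_self _ _ _

theorem trace_glue : (glue p).trace = ∑ i, p.1.1 i := by
  simp only [trace, rdiag_glue]
  exact Equiv.sum_comp Fin.revPerm p.1.1

theorem size_glue : (glue p).size = ∑ i, p.1.1 i + (p.2.1.offDiag + p.2.2.offDiag) := by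
  have h : ∀ i j, glueFun p.2.1 p.2.2 i j = (if i = j then p.1.1 i else 0) +
      ((if i < j then p.2.1.1 i j else 0) + if j < i then p.2.2.1 j i else 0) := by
    intro i j
    rcases lt_trichotomy i j with h | rfl | h
    · simp [glueFun, h.le, h, h.ne, h.not_gt]
    · simp [glueFun_self]
    · simp [glueFun, h.not_ge, h, h.ne', h.not_gt]
  change ∑ i, ∑ j, glueFun p.2.1 p.2.2 i j = _
  simp only [h, Finset.sum_add_distrib, Finset.sum_ite_eq, Finset.mem_univ, if_true,
    TriFilling.offDiag, TriFilling.sum_Ioi_eq]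
  rw [Finset.sum_comm (f := fun i j => if j < i then p.2.2.1 j i else 0)]

end SquareRPP

/-! ### Shifted exponents -/

/-- The numbers `v_i = μ_i + n - i`, where `μ` is the monotone sequence `d` read backwards. -/
def shiftedExponents {n : ℕ} (d : Fin n → ℕ) (i : Fin n) : ℕ := d i.rev + (n - (i.val + 1))

theorem strictAnti_shiftedExponents {n : ℕ} {d : Fin n → ℕ} (hd : Monotone d) :
    StrictAnti (shiftedExponents d) := by
  intro i j hij
  have := hd (Fin.rev_le_rev.2 hij.le)
  have h : i.val < j.val := hij
  have := j.isLt
  unfold shiftedExponents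
  omega

/-- Every strictly decreasing sequence of natural numbers has the form `μ_i + n - i`. -/
theorem StrictAnti.exists_shiftedExponents_eq {n : ℕ} {w : Fin n → ℕ} (hw : StrictAnti w) :
    ∃ d : Fin n → ℕ, Monotone d ∧ shiftedExponents d = w := by
  have key : ∀ k : ℕ, ∀ i j : Fin n, j.val = i.val + k → w j + k ≤ w i := by
    intro k
    induction k with
    | zero => intro i j h; rw [Fin.ext (h.trans (add_zero _))]; simp
    | succ k ih =>
      intro i j h
      have h1 := ih i ⟨i.val + k, by omega⟩ rfl
      have h3 : (⟨i.val + k, by omega⟩ : Fin n) < j := by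
        rw [Fin.lt_def]
        dsimp only
        omega
      have h2 := hw h3
      omega
  have hbound : ∀ i, n - (i.val + 1) ≤ w i := fun i => by
    have hi := i.isLt
    have := key (n - (i.val + 1)) i ⟨n - 1, by omega⟩ (by dsimp only; omega)
    omega
  refine ⟨fun i => w i.rev - i.val, fun i j hij => ?_, funext fun i => ?_⟩
  · have h1 := key (j.val - i.val) j.rev i.rev (by
      simp only [Fin.val_rev]; have : i.val ≤ j.val := hij; omega)
    have : i.val ≤ j.val := hij
    dsimp only
    omega
  · have := hbound i
    simp only [shiftedExponents, Fin.rev_rev, Fin.val_rev]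
    omega

theorem sum_fin_val (n : ℕ) : ∑ i : Fin n, i.val = n.choose 2 := by
  rw [Fin.sum_univ_eq_sum_range (fun i => i), Finset.sum_range_id, Nat.choose_two_right]

theorem sum_shiftedExponents {n : ℕ} (d : Fin n → ℕ) :
    ∑ i, shiftedExponents d i = ∑ i, d i + n.choose 2 := by
  simp only [shiftedExponents, Finset.sum_add_distrib]
  congr 1
  · exact Equiv.sum_comp Fin.revPerm d
  · rw [← sum_fin_val, ← Equiv.sum_comp Fin.revPerm]
    refine Finset.sum_congr rfl fun i _ => ?_
    rw [Fin.revPerm_apply, Fin.val_rev]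
    have := i.isLt
    omega

open Matrix in
/-- The two determinants differ by the sign of the reversal of the rows. -/
theorem vandermonde_shiftedExponents_sq {n : ℕ} (q : ℝ) (d : Fin n → ℕ) :
    (vandermonde fun i => q ^ shiftedExponents d i).det ^ 2 =
      (vandermonde fun i => q ^ (d i + i.val)).det ^ 2 := by
  have h : (vandermonde fun i => q ^ shiftedExponents d i) =
      (vandermonde fun i => q ^ (d i + i.val)).submatrix Fin.revPerm id := by
    ext i j
    simp [vandermonde_apply, shiftedExponents, Fin.val_rev]
  rw [h, Matrix.det_permute, mul_pow]
  rcases Int.units_eq_one_or (Equiv.Perm.sign (Fin.revPerm : Equiv.Perm (Fin n))) with h | h <;>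
    simp [h]

open Matrix in
theorem vandermonde_pow_sq {q : ℝ} (hq0 : 0 < q) (hq1 : q < 1) :
    ∀ n : ℕ, (vandermonde fun i : Fin n => q ^ i.val).det ^ 2 =
      q ^ (2 * n.choose 3) * ∏ j ∈ Finset.Icc 1 (n - 1), qShifted q q j ^ 2
  | 0 => by simp
  | n + 1 => by
    have ih := vandermonde_pow_sq hq0 hq1 n
    have hr := vandermonde_pow_succ hq0 hq1 n
    have hsum : ∏ i : Fin n, q ^ i.val = q ^ n.choose 2 := by
      rw [Finset.prod_pow_eq_pow_sum, sum_fin_val]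
    have hP : (∏ j : Fin n, (q ^ (j.val + 1) - 1)) ^ 2 = qShifted q q n ^ 2 := by
      rw [Fin.prod_univ_eq_prod_range (fun j => q ^ (j + 1) - 1), qShifted, ← Finset.prod_pow,
        ← Finset.prod_pow]
      refine Finset.prod_congr rfl fun l _ => ?_
      ring
    have hne : ∏ j : Fin n, (q ^ (j.val + 1) - 1) ≠ 0 := Finset.prod_ne_zero_iff.2 fun j _ =>
      sub_ne_zero.2 (pow_lt_one₀ hq0.le hq1 (by omega)).ne
    rw [Finset.prod_inv_distrib, hsum, eq_inv_mul_iff_mul_eq₀ hne] at hr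
    have hprod : ∏ j ∈ Finset.Icc 1 (n + 1 - 1), qShifted q q j ^ 2 =
        (∏ j ∈ Finset.Icc 1 (n - 1), qShifted q q j ^ 2) * qShifted q q n ^ 2 := by
      cases n with
      | zero => simp [qShifted]
      | succ n => simpa using Finset.prod_Icc_succ_top (by omega) _
    rw [← hr, mul_pow, mul_pow, ih, hP, hprod, Nat.choose_succ_succ' n 2]
    ring

/-! ### The `q`-Selberg integral as a sum over diagonals -/

/-- The Vandermonde factor of the integrand vanishes unless the exponents are distinct, so only
the points `q ^ v` with `v` strictly decreasing contribute. -/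
theorem hasSum_qSelberg {q : ℝ} (hq0 : 0 < q) (hq1 : q < 1) (n α β m : ℕ) :
    QMultiIntegrable q n (orderedSimplex n) (qSelbergIntegrand q n α β m) ∧
    HasSum (fun d : {d : Fin n → ℕ // Monotone d} =>
      (1 - q) ^ n * (qSelbergIntegrand q n α β m (fun i => q ^ shiftedExponents d.1 i) *
        ∏ i, q ^ shiftedExponents d.1 i)) (qSelbergIntegral q n α β m) := by
  obtain ⟨C, hC⟩ := abs_qSelbergIntegrand_le hq0 n α β m
  have h := qMultiIntegral_scaledSimplex hq0 hq1 zero_le_one hC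
  refine ⟨h.1, ?_⟩
  have h2 := h.2
  simp only [one_mul] at h2
  let g : {d : Fin n → ℕ // Monotone d} → {w : Fin n → ℕ // Antitone w} := fun d =>
    ⟨shiftedExponents d.1, (strictAnti_shiftedExponents d.2).antitone⟩
  have hg : Function.Injective g := by
    intro d d' hdd
    refine Subtype.ext (funext fun i => ?_)
    have := congrFun (congrArg Subtype.val hdd) i.rev
    simpa [g, shiftedExponents] using this
  refine (hg.hasSum_iff ?_).2 h2
  rintro ⟨w, hw⟩ hnot
  have : ¬ Function.Injective w := fun hinj => by
    obtain ⟨d, hd, rfl⟩ := (hw.strictAnti_of_injective hinj).exists_shiftedExponents_eq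
    exact hnot ⟨⟨d, hd⟩, rfl⟩
  obtain ⟨i, j, hij, hne⟩ : ∃ i j, w i = w j ∧ i ≠ j := by
    simpa [Function.Injective] using this
  have hdet : ∏ i : Fin n, ∏ j ∈ Finset.Ioi i, (q ^ w j - q ^ w i) = 0 := by
    rw [← Matrix.det_vandermonde (fun i => q ^ w i)]
    exact Matrix.det_vandermonde_eq_zero_iff.2 ⟨i, j, by simp [hij], hne⟩
  simp [qSelbergIntegrand, hdet]

/-- The part of the weight of a reverse plane partition that depends only on its diagonal `d`,
including `q` to the sum of the diagonal entries. -/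
def diagWeight (q : ℝ) (a b m : ℕ) {n : ℕ} (d : Fin n → ℕ) : ℝ :=
  q ^ ((a + 1) * ∑ i, d i) * (∏ i, qShifted (q ^ (shiftedExponents d i + 1)) q b) *
      ∏ i, ∏ j ∈ Finset.Ioi i, (q ^ shiftedExponents d j) ^ (2 * m - 1) *
        qShifted (q ^ (1 - (m : ℤ) + (shiftedExponents d i : ℤ) -
          (shiftedExponents d j : ℤ))) q (2 * m - 1) /
        (q ^ shiftedExponents d j - q ^ shiftedExponents d i)

open Matrix in
/-- Term by term comparison: the summand of the `q`-Selberg series at `q ^ v`, times the constant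
of the theorem, is the total weight of the reverse plane partitions with diagonal `d`. One of the two
Vandermonde factors that come from the two triangles cancels the denominator of the weight, the other
is the Vandermonde factor of the integrand. -/
theorem weight_eq {q : ℝ} (hq0 : 0 < q) (hq1 : q < 1) {n : ℕ} (a b m : ℕ)
    (d : {d : Fin n → ℕ // Monotone d}) :
    q ^ ((-1 - (a : ℤ)) * (n.choose 2 : ℤ) - 2 * (n.choose 3 : ℤ)) /
        ((1 - q) ^ n * ∏ j ∈ Finset.Icc 1 (n - 1), qShifted q q j ^ 2) *
      ((1 - q) ^ n * (qSelbergIntegrand q n (a + 1) (b + 1) m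
        (fun i => q ^ shiftedExponents d.1 i) * ∏ i, q ^ shiftedExponents d.1 i)) =
    ((vandermonde fun i => q ^ (d.1 i + i.val)).det /
          (vandermonde fun i : Fin n => q ^ i.val).det) ^ 2 *
      diagWeight q a b m d.1 := by
  set v := shiftedExponents d.1 with hv
  have hV : (vandermonde fun i => q ^ v i).det ≠ 0 := by
    rw [det_vandermonde_ne_zero_iff]
    exact (pow_right_strictAnti₀ hq0 hq1).injective.comp
      (strictAnti_shiftedExponents d.2).injective
  have hV0 := vandermonde_pow_ne_zero hq0 hq1 n
  have hVdef := Matrix.det_vandermonde fun i => q ^ v i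
  have hsq := vandermonde_pow_sq hq0 hq1 n
  have harg : ∀ i j, q ^ (1 - (m : ℤ)) * q ^ v i / q ^ v j =
      q ^ (1 - (m : ℤ) + (v i : ℤ) - (v j : ℤ)) := fun i j => by
    rw [zpow_sub₀ hq0.ne' _ (v j : ℤ), zpow_add₀ hq0.ne', zpow_natCast, zpow_natCast]
  simp only [diagWeight, ← hv, qSelbergIntegrand, harg, Nat.add_sub_cancel, Finset.prod_div_distrib]
  rw [← hVdef, div_pow, ← vandermonde_shiftedExponents_sq, ← hv, hsq]
  have hq' : (1 - q) ^ n ≠ 0 := pow_ne_zero _ (by linarith)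
  have hR : ∏ j ∈ Finset.Icc 1 (n - 1), qShifted q q j ^ 2 ≠ 0 := by
    intro h
    rw [h, mul_zero] at hsq
    exact pow_ne_zero 2 hV0 hsq
  have hx : ∏ i, q ^ v i = q ^ (∑ i, d.1 i + n.choose 2) := by
    rw [Finset.prod_pow_eq_pow_sum, sum_shiftedExponents]
  have hexp : q ^ ((-1 - (a : ℤ)) * (n.choose 2 : ℤ) - 2 * (n.choose 3 : ℤ)) =
      (q ^ ((a + 1) * n.choose 2))⁻¹ * (q ^ (2 * n.choose 3))⁻¹ := by
    rw [← zpow_natCast, ← zpow_natCast, ← _root_.zpow_neg, ← _root_.zpow_neg, ← zpow_add₀ hq0.ne']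
    congr 1
    push_cast
    ring
  simp_rw [← pow_succ']
  rw [Finset.prod_mul_distrib (f := fun i => (q ^ v i) ^ a),
    Finset.prod_pow _ a (fun i => q ^ v i), hx, hexp]
  have h3 : q ^ (2 * n.choose 3) ≠ 0 := by positivity
  have h2 : q ^ ((a + 1) * n.choose 2) ≠ 0 := by positivity
  have hpow : (q ^ (∑ i, d.1 i + n.choose 2)) ^ a * q ^ (∑ i, d.1 i + n.choose 2) =
      q ^ ((a + 1) * ∑ i, d.1 i) * q ^ ((a + 1) * n.choose 2) := by
    ring
  generalize (q ^ (∑ i, d.1 i + n.choose 2)) ^ a = A at *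
  generalize q ^ (∑ i, d.1 i + n.choose 2) = A' at *
  generalize q ^ ((a + 1) * ∑ i, d.1 i) = B at *
  generalize q ^ ((a + 1) * n.choose 2) = B' at *
  generalize ∏ j ∈ Finset.Icc 1 (n - 1), qShifted q q j ^ 2 = R at *
  generalize (∏ i, qShifted (q ^ (v i + 1)) q b) = X at *
  generalize (∏ i, ∏ j ∈ Finset.Ioi i, (q ^ v j) ^ (2 * m - 1) *
    qShifted (q ^ (1 - (m : ℤ) + (v i : ℤ) - (v j : ℤ))) q (2 * m - 1)) = Y at *
  generalize (vandermonde fun i => q ^ v i).det = V at *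
  field_simp
  linear_combination Y * X * hpow

end

theorem theorem7p10 (n a b m : ℕ) (hm : 1 ≤ m) (q : ℝ) (hq0 : 0 < q) (hq1 : q < 1) :
    QMultiIntegrable q n (orderedSimplex n) (qSelbergIntegrand q n (a + 1) (b + 1) m) ∧
    HasSum (fun T : SquareRPP n => T.wt q a b m)
      (q ^ ((-1 - (a : ℤ)) * (n.choose 2 : ℤ) - 2 * (n.choose 3 : ℤ)) /
          ((1 - q) ^ n * ∏ j ∈ Finset.Icc 1 (n - 1), qShifted q q j ^ 2) *
        qSelbergIntegral q n (a + 1) (b + 1) m) := by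
  obtain ⟨hint, hsum⟩ := hasSum_qSelberg hq0 hq1 n (a + 1) (b + 1) m
  refine ⟨hint, ?_⟩
  have hS := hsum.mul_left (q ^ ((-1 - (a : ℤ)) * (n.choose 2 : ℤ) - 2 * (n.choose 3 : ℤ)) /
          ((1 - q) ^ n * ∏ j ∈ Finset.Icc 1 (n - 1), qShifted q q j ^ 2))
  simp only [weight_eq hq0 hq1] at hS
  rw [← (Equiv.ofBijective _ (SquareRPP.glue_bijective n)).hasSum_iff]
  have hwt : ∀ p : (Σ d : {d : Fin n → ℕ // Monotone d}, TriFilling n d.1 × TriFilling n d.1),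
      (SquareRPP.glue p).wt q a b m = q ^ (p.2.1.offDiag + p.2.2.offDiag) *
      diagWeight q a b m p.1.1 := fun p => by
    have hv : ∀ i, (SquareRPP.glue p).v i = shiftedExponents p.1.1 i := fun i => by
      rw [SquareRPP.v, SquareRPP.rdiag_glue, shiftedExponents]
    simp only [diagWeight, SquareRPP.wt, hv, SquareRPP.size_glue, SquareRPP.trace_glue]
    rw [show ∑ i, p.1.1 i + (p.2.1.offDiag + p.2.2.offDiag) + a * ∑ i, p.1.1 i =
      p.2.1.offDiag + p.2.2.offDiag + (a + 1) * ∑ i, p.1.1 i by ring, pow_add]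
    simp only [mul_assoc]
  have hf : (fun T : SquareRPP n => T.wt q a b m) ∘
      (Equiv.ofBijective _ (SquareRPP.glue_bijective n)) =
      fun p => q ^ (p.2.1.offDiag + p.2.2.offDiag) * diagWeight q a b m p.1.1 := funext hwt
  rw [hf]
  refine hasSum_sigma_of_abs hS hS.summable.abs
    (fun d => (TriFilling.hasSum_pow_offDiag_add hq0 hq1 d.2).mul_right _) fun d => ?_
  simp only [abs_mul, abs_of_pos (pow_pos hq0 _), abs_sq]
  exact (TriFilling.hasSum_pow_offDiag_add hq0 hq1 d.2).mul_right _
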